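/- Let $K$ be an algebraically closed field, $p$ a prime number with $\operatorname{char} K\ne p$, $h\ge 1$ and $n\ge 3$ integers, and $q=p^h$. Let $T=\{a\in\mathbf N^n : a_1+\dots+a_n=q\}$, and let $V\subset K^{T}$ be the affine variety parametrized by all monomials of degree $q$, that is, the image of the map $K^n\to K^T$, $u=(u_1,\dots,u_n)\mapsto (u^a)_{a\in T}$, where $u^a=u_1^{a_1}\cdots u_n^{a_n}$. Regard $K^n$ and $V$ as the affine schemes defined by their coordinate rings $K[u_1,\dots,u_n]$ and $K[x_a : a\in T]/I(V)$, where $I(V)$ is the ideal of all polynomials vanishing on $V$. Then the morphism of schemes $$\phi: K^n\setminus\{0\}\longrightarrow V\setminus\{0\},\qquad u\mapsto (u^a)_{a\in T},$$ is a finite Galois covering with cyclic Galois group of order $q$, namely the group $\mu_q=\mu_q(K)$ of $q$-th roots of unity in $K$, acting on $K^n\setminus\{0\}$ by $\zeta\cdot u=(\zeta u_1,\dots,\zeta u_n)$. In detail: (a) $\phi$ is finite, étale and surjective. (b) $\phi$ is a Galois covering with Galois group $\mu_q$: it is faithfully flat, $\mu_q$ acts on $Y=K^n\setminus\{0\}$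 over $X=V\setminus\{0\}$, and the morphism $\coprod_{\zeta\in\mu_q}Y\to Y\times_X Y$ that is $(\mathrm{id},\zeta)$ on the component indexed by $\zeta$ is an isomorphism. (c) $\mu_q$ is cyclic of order $q$. (d) For every point $w\in V\setminus\{0\}$ (with coordinates in $K$), the fibre $\{u\in K^n\setminus\{0\} : \phi(u)=w\}$ is non-empty, is stable under $\mu_q$, and $\mu_q$ acts simply transitively on it. -/

import Mathlib

open CategoryTheory CategoryTheory.Limits AlgebraicGeometry MvPolynomial

universe u

noncomputable section

/-- Let `G` be a finite group acting on the scheme `Y` through `ρ`, and let `f : Y ⟶ X` be a morphism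
of schemes. Then `f` is a (finite) Galois covering with Galois group `G` (with respect to the given
action) if `f` is faithfully flat (i.e. flat and surjective), `G` acts on `Y` over `X`, and the
morphism `G × Y = ∐_{g ∈ G} Y ⟶ Y ×_X Y`, `(g, y) ↦ (y, g y)`, is an isomorphism. -/
structure IsGaloisCovering {Y X : Scheme.{u}} (f : Y ⟶ X) (G : Type u) [Group G] [Finite G]
    (ρ : G →* Aut Y) : Prop where
  flat : Flat f
  surjective : Surjective f
  over_base : ∀ g : G, (ρ g).hom ≫ f = f
  isIso_actionMap :
    IsIso (Sigma.desc (fun g : G => pullback.lift (𝟙 Y) (ρ g).hom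
        (by rw [Category.id_comp, over_base g])) :
      (∐ fun _ : G => Y) ⟶ pullback f f)

namespace Veronese

/-- The exponent vectors of the monomials of degree `q` in `n` variables. -/
abbrev Exponent (n q : ℕ) : Type := {a : Fin n → ℕ // ∑ i, a i = q}

/-- The monomial parametrization `u ↦ (u ^ a)_a`, where `u ^ a` runs through all monomials of
degree `q`. -/
def param (K : Type u) [Field K] (n q : ℕ) (x : Fin n → K) : Exponent n q → K :=
  fun a => ∏ i, x i ^ a.1 i

/-- The variety `V` (the affine cone over the Veronese variety), as the set of points of the affine
space `K ^ |T|` given by the parametrization. -/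
def variety (K : Type u) [Field K] (n q : ℕ) : Set (Exponent n q → K) :=
  Set.range (param K n q)

/-- The coordinate ring of `V`: the polynomial ring modulo the ideal of all polynomials that
vanish on `V`. -/
abbrev CoordRing (K : Type u) [Field K] (n q : ℕ) : Type u :=
  MvPolynomial (Exponent n q) K ⧸ vanishingIdeal K (variety K n q)

/-- The coordinate function on `V` with index `a`. -/
def coord (K : Type u) [Field K] (n q : ℕ) (a : Exponent n q) : CoordRing K n q :=
  Ideal.Quotient.mk _ (X a)

/-- Substitution of the monomials of degree `q` for the coordinates. -/
def monomialHom (K : Type u) [Field K] (n q : ℕ) :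
    MvPolynomial (Exponent n q) K →ₐ[K] MvPolynomial (Fin n) K :=
  aeval fun a => ∏ i, X i ^ a.1 i

lemma aeval_monomialHom (K : Type u) [Field K] (n q : ℕ) (x : Fin n → K)
    (P : MvPolynomial (Exponent n q) K) :
    eval x (monomialHom K n q P) = aeval (param K n q x) P := by
  have : (aeval x).comp (monomialHom K n q) = aeval (R := K) (param K n q x) := by
    ext a
    simp [monomialHom, param]
  simpa [aeval_eq_eval] using DFunLike.congr_fun this P

lemma monomialHom_eq_zero (K : Type u) [Field K] [Infinite K] (n q : ℕ)
    (P : MvPolynomial (Exponent n q) K) (hP : P ∈ vanishingIdeal K (variety K n q)) :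
    monomialHom K n q P = 0 := by
  refine MvPolynomial.funext fun x => ?_
  rw [aeval_monomialHom, map_zero]
  exact hP _ ⟨x, rfl⟩

/-- The comorphism `K[V] → K[u_1, …, u_n]` of the parametrization `K ^ n → V`. -/
def comorphism (K : Type u) [Field K] [Infinite K] (n q : ℕ) :
    CoordRing K n q →ₐ[K] MvPolynomial (Fin n) K :=
  Ideal.Quotient.liftₐ _ (monomialHom K n q) (monomialHom_eq_zero K n q)

/-- The open subscheme of `Spec A` obtained by removing the common zeros of a family of functions
`c`. If `c` is a family of coordinate functions of an affine variety which contains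
the origin, this is the complement of the origin. -/
def puncture {A : Type u} [CommRing A] {σ : Type*} (c : σ → A) :
    (Spec (CommRingCat.of A)).Opens :=
  ⟨(PrimeSpectrum.zeroLocus (Set.range c))ᶜ,
    (PrimeSpectrum.isClosed_zeroLocus (Set.range c)).isOpen_compl⟩

lemma mem_puncture {A : Type u} [CommRing A] {σ : Type*} (c : σ → A)
    (x : Spec (CommRingCat.of A)) : x ∈ puncture c ↔ ∃ s, c s ∉ x.asIdeal := by
  change ¬ (Set.range c ⊆ x.asIdeal) ↔ _
  simp [Set.range_subset_iff]

/-- The scheme `K ^ n ∖ {0}`. -/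
abbrev affinePunctured (K : Type u) [Field K] (n : ℕ) : (Spec (.of (MvPolynomial (Fin n) K))).Opens :=
  puncture (X : Fin n → MvPolynomial (Fin n) K)

/-- The scheme `V ∖ {0}`. -/
abbrev varietyPunctured (K : Type u) [Field K] (n q : ℕ) : (Spec (.of (CoordRing K n q))).Opens :=
  puncture (coord K n q)

lemma affinePunctured_le (K : Type u) [Field K] [Infinite K] (n q : ℕ) :
    affinePunctured K n ≤ Spec.map (CommRingCat.ofHom (comorphism K n q).toRingHom) ⁻¹ᵁ
      varietyPunctured K n q := by
  intro x hx
  obtain ⟨i, hi⟩ := (mem_puncture _ x).1 hx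
  refine (mem_puncture _ _).2 ⟨⟨Pi.single i q, by simp⟩, fun h => hi ?_⟩
  have h' : comorphism K n q (coord K n q ⟨Pi.single i q, by simp⟩) ∈ x.asIdeal := h
  have e : comorphism K n q (coord K n q ⟨Pi.single i q, by simp⟩) = X i ^ q := by
    change monomialHom K n q (X _) = _
    simp only [monomialHom, aeval_X]
    rw [Finset.prod_eq_single i (fun j _ hj => by simp [hj]) (by simp)]
    simp
  rw [e] at h'
  exact x.isPrime.mem_of_pow_mem _ h'

/-- The morphism of schemes `φ : K ^ n ∖ {0} ⟶ V ∖ {0}` given by the monomials of degree `q`. -/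
def phi (K : Type u) [Field K] [Infinite K] (n q : ℕ) :
    (affinePunctured K n).toScheme ⟶ (varietyPunctured K n q).toScheme :=
  (Spec.map (CommRingCat.ofHom (comorphism K n q).toRingHom)).resLE
    (varietyPunctured K n q) (affinePunctured K n) (affinePunctured_le K n q)

/-- The comorphism of the homothety `(u_1, …, u_n) ↦ (c u_1, …, c u_n)` of `K ^ n`. -/
def scaleHom (K : Type u) [Field K] (n : ℕ) (c : K) :
    MvPolynomial (Fin n) K →ₐ[K] MvPolynomial (Fin n) K :=
  aeval fun i => C c * X i

lemma scale_le (K : Type u) [Field K] (n : ℕ) (c : Kˣ) :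
    affinePunctured K n ≤ Spec.map (CommRingCat.ofHom (scaleHom K n (c : K)).toRingHom) ⁻¹ᵁ
      affinePunctured K n := by
  intro x hx
  obtain ⟨i, hi⟩ := (mem_puncture _ x).1 hx
  refine (mem_puncture _ _).2 ⟨i, fun h => hi ?_⟩
  have h' : scaleHom K n (c : K) (X i) ∈ x.asIdeal := h
  have := x.asIdeal.mul_mem_left (C ((c⁻¹ : Kˣ) : K)) h'
  simpa [scaleHom, ← mul_assoc, ← C_mul] using this

/-- The homothety of `K ^ n ∖ {0}` with factor `c`. -/
def scale (K : Type u) [Field K] (n : ℕ) (c : Kˣ) :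
    (affinePunctured K n).toScheme ⟶ (affinePunctured K n).toScheme :=
  (Spec.map (CommRingCat.ofHom (scaleHom K n (c : K)).toRingHom)).resLE _ _ (scale_le K n c)

lemma scale_one (K : Type u) [Field K] (n : ℕ) : scale K n 1 = 𝟙 _ := by
  have : CommRingCat.ofHom (scaleHom K n ((1 : Kˣ) : K)).toRingHom = 𝟙 _ := by
    ext x
    · simp [scaleHom]
    · simp [scaleHom]
  rw [← cancel_mono (affinePunctured K n).ι, scale, Scheme.Hom.resLE_comp_ι, this]
  simp

lemma scale_mul (K : Type u) [Field K] (n : ℕ) (c d : Kˣ) :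
    scale K n (c * d) = scale K n d ≫ scale K n c := by
  have : CommRingCat.ofHom (scaleHom K n ((c * d : Kˣ) : K)).toRingHom =
      CommRingCat.ofHom (scaleHom K n (c : K)).toRingHom ≫
        CommRingCat.ofHom (scaleHom K n (d : K)).toRingHom := by
    ext x
    · simp [scaleHom]
    · simp [scaleHom, mul_assoc]
  rw [← cancel_mono (affinePunctured K n).ι, scale, Scheme.Hom.resLE_comp_ι, this, scale, scale,
    Category.assoc, Scheme.Hom.resLE_comp_ι, Scheme.Hom.resLE_comp_ι_assoc, Spec.map_comp]

/-- The action of the group `Kˣ` on `K ^ n ∖ {0}` by homotheties. -/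
def scaleAction (K : Type u) [Field K] (n : ℕ) : Kˣ →* Aut (affinePunctured K n).toScheme where
  toFun c :=
    { hom := scale K n c
      inv := scale K n c⁻¹
      hom_inv_id := by rw [← scale_mul, inv_mul_cancel, scale_one]
      inv_hom_id := by rw [← scale_mul, mul_inv_cancel, scale_one] }
  map_one' := by
    ext : 1
    exact scale_one K n
  map_mul' c d := by
    ext : 1
    exact scale_mul K n c d

/-- The action of the group `μ_q` of the `q`-th roots of unity on `K ^ n ∖ {0}` by homotheties. -/
def rootsAction (K : Type u) [Field K] (n q : ℕ) :
    rootsOfUnity q K →* Aut (affinePunctured K n).toScheme :=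
  (scaleAction K n).comp (rootsOfUnity q K).subtype

/-- The fibre over `w` of the map `K ^ n ∖ {0} → V ∖ {0}`, `u ↦ (u ^ a)_a`, on points. -/
def fibre (K : Type u) [Field K] (n q : ℕ) (w : Exponent n q → K) : Set (Fin n → K) :=
  {x | x ≠ 0 ∧ param K n q x = w}

end Veronese

end

/-!
Write `A = K[V]`, `B = K[u_1, …, u_n]` and let `φ : A → B` be the comorphism. It is injective, and
`B` is integral over `A` because `u_i ^ q` lies in the image. So `Spec φ` is finite and surjective,
and `phi` is its restriction to the complement of the origin (`preimage_varietyPunctured`).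

Étaleness is local on the source. On the locus `u_i ≠ 0` the identity
`u_j = (u_i ^ (q - 1) u_j) u_i ^ (1 - q)` shows that `B[1 / u_i]` is generated over `A` by `u_i` and
its inverse, so it is a quotient of `A[T, 1 / T] / (T ^ q - x)`, where `x` is the coordinate that
maps to `u_i ^ q`. There are no further relations: a polynomial over `A` that vanishes at `u_i`
also vanishes, after applying the homotheties, at the `q` distinct elements `ζ u_i` of the domain
`B` with `ζ ∈ μ_q`, so it is zero if its degree is less than `q`
(`eq_zero_of_eval₂_comorphism`). As `q` is invertible, this is a standard étale algebra
(`Algebra.Etale.of_adjoin_root_of_isUnit`).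

For the Galois property, the graphs `Y ⟶ Y ×_X Y` of the automorphisms `ζ` are open immersions since
`phi` is étale, so it suffices that their images are disjoint and cover `Y ×_X Y`. This can be tested
on points with values in fields `L` (`IsGaloisCovering.of_etale`): two nonzero points of `L ^ n` at
which all monomials of degree `q` agree differ by a unique `q`-th root of unity
(`exists_smul_of_monomials_eq`), and `K` contains all `q`-th roots of unity of `L`. The same fact
over `L = K` describes the fibres.
-/

/-! ### Étale algebras and Galois coverings -/

/-- If `u` is a unit of `S` with `u ^ q = a ∈ A`, where `q` is invertible in `A`, if `u` and `u⁻¹`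
generate `S` over `A`, and if `1, u, …, u ^ (q - 1)` are linearly independent over `A` (this is
`hinj`), then `S = A[T, 1 / T] / (T ^ q - a)` is étale over `A`. -/
theorem Algebra.Etale.of_adjoin_root_of_isUnit {A S : Type*} [CommRing A] [Nontrivial A]
    [CommRing S] [Algebra A S] {q : ℕ} (hq0 : q ≠ 0) (hq : IsUnit (q : A)) (a : A) (u : Sˣ)
    (hua : (u : S) ^ q = algebraMap A S a)
    (hgen : Algebra.adjoin A {(u : S), ((u⁻¹ : Sˣ) : S)} = ⊤)
    (hinj : ∀ P : Polynomial A, P.natDegree < q → Polynomial.aeval (u : S) P = 0 → P = 0) :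
    Algebra.Etale A S := by
  obtain ⟨c, hc⟩ := hq.exists_left_inv
  have hmonic : (Polynomial.X ^ q - Polynomial.C a).Monic := Polynomial.monic_X_pow_sub_C a hq0
  let P : StandardEtalePair A :=
    { f := Polynomial.X ^ q - Polynomial.C a
      monic_f := hmonic
      g := Polynomial.X
      cond := ⟨Polynomial.C c, 0, q - 1, by
        have : Polynomial.C c * (q : Polynomial A) = 1 := by
          rw [← Polynomial.C_eq_natCast, ← Polynomial.C_mul, hc, Polynomial.C_1]
        simp only [Polynomial.derivative_sub, Polynomial.derivative_X_pow,
          Polynomial.derivative_C, Polynomial.C_eq_natCast]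
        linear_combination (Polynomial.X ^ (q - 1)) * this⟩ }
  have hP : P.HasMap (u : S) := ⟨by simp [P, hua], by simp [P]⟩
  have hroot (r : Polynomial A) (hr : Polynomial.aeval (u : S) r = 0) : P.f ∣ r := by
    rw [← Polynomial.modByMonic_eq_zero_iff_dvd hmonic]
    refine hinj _ ?_ ?_
    · have := Polynomial.natDegree_modByMonic_lt r hmonic fun h => hq0 <| by
        simpa using congr(Polynomial.natDegree $h)
      simpa using this
    · rw [Polynomial.modByMonic_eq_sub_mul_div, map_sub, hr, map_mul, hP.1]
      simp
  have hinv : ∃ y, P.X * y = 1 := by simpa [P] using (P.hasMap_X.2).exists_right_inv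
  obtain ⟨y, hy⟩ := hinv
  have hyu : P.lift _ hP y = ((u⁻¹ : Sˣ) : S) := by
    have := congr(P.lift _ hP $hy)
    rw [map_mul, P.lift_X, map_one] at this
    exact (Units.inv_eq_of_mul_eq_one_right this).symm
  have hsurj : Function.Surjective (P.lift _ hP) := by
    refine AlgHom.range_eq_top _ |>.1 <| top_le_iff.1 <| hgen.symm.le.trans <|
      Algebra.adjoin_le ?_
    rintro _ (rfl | rfl)
    exacts [⟨P.X, P.lift_X _ hP⟩, ⟨y, hyu⟩]
  have hbij : Function.Bijective (P.lift _ hP) := by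
    refine ⟨(injective_iff_map_eq_zero _).2 fun s hs => ?_, hsurj⟩
    -- Clear the denominators of `s`, which are powers of the root.
    obtain ⟨r, k, hr⟩ : ∃ (r : Polynomial A) (k : ℕ), s * P.X ^ k = Polynomial.aeval P.X r := by
      let Q : StandardEtalePresentation A P.Ring :=
        ⟨P, P.X, P.hasMap_X, by simpa [StandardEtalePair.lift_X_left] using Function.bijective_id⟩
      obtain ⟨r, k, hr⟩ := Q.exists_mul_aeval_x_g_pow_eq_aeval_x s
      exact ⟨r, k, by simpa [Q, P] using hr⟩
    have h0 : Polynomial.aeval (u : S) r = 0 := by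
      have := congr(P.lift _ hP $hr)
      rwa [map_mul, hs, zero_mul, ← Polynomial.aeval_algHom_apply, P.lift_X, eq_comm] at this
    obtain ⟨t, rfl⟩ := hroot r h0
    rw [map_mul, P.hasMap_X.1, zero_mul] at hr
    have := congr($hr * y ^ k)
    rwa [mul_assoc, ← mul_pow, hy, one_pow, mul_one, zero_mul] at this
  have : Algebra.IsStandardEtale A S := ⟨⟨⟨P, _, hP, hbij⟩⟩⟩
  infer_instance

/-- The graph of an automorphism over the base is the diagonal followed by an automorphism of the
fibre product, so it is an open immersion when the morphism is étale. -/
theorem isOpenImmersion_graph {Y X : Scheme.{u}} (f : Y ⟶ X) [Etale f] (g : Y ⟶ Y) [IsIso g]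
    (hg : g ≫ f = f) :
    IsOpenImmersion (pullback.lift (𝟙 Y) g (by rw [Category.id_comp, hg]) : Y ⟶ pullback f f) := by
  have : (pullback.lift (𝟙 Y) g (by rw [Category.id_comp, hg]) : Y ⟶ pullback f f) =
      pullback.diagonal f ≫ pullback.map f f f f (𝟙 Y) g (𝟙 X) (by simp) (by simp [hg]) := by
    apply pullback.hom_ext <;> simp [pullback.lift_fst, pullback.lift_snd]
  rw [this]
  infer_instance

/-- A surjective étale morphism is a Galois covering with group `G` if, for every field `L`, the
group `G` acts simply transitively on the nonempty fibres of the map on `L`-valued points. -/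
theorem IsGaloisCovering.of_etale {Y X : Scheme.{u}} (f : Y ⟶ X) [Etale f] [Surjective f]
    (G : Type u) [Group G] [Finite G] (ρ : G →* Aut Y) (hρ : ∀ g : G, (ρ g).hom ≫ f = f)
    (h : ∀ (L : Type u) [Field L] (y y' : Spec (.of L) ⟶ Y), y ≫ f = y' ≫ f →
      ∃! g : G, y ≫ (ρ g).hom = y') : IsGaloisCovering f G ρ := by
  refine ⟨inferInstance, inferInstance, hρ, ?_⟩
  let γ (g : G) : Y ⟶ pullback f f :=
    pullback.lift (𝟙 Y) (ρ g).hom (by rw [Category.id_comp, hρ])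
  have hγ (g : G) : IsOpenImmersion (γ g) :=
    have : IsIso (ρ g).hom := (ρ g).isIso_hom
    isOpenImmersion_graph f (ρ g).hom (hρ g)
  have hγ₁ (g : G) : γ g ≫ pullback.fst f f = 𝟙 Y := pullback.lift_fst _ _ _
  have hγ₂ (g : G) : γ g ≫ pullback.snd f f = (ρ g).hom := pullback.lift_snd _ _ _
  have hdisj : Pairwise (Function.onFun Disjoint fun g => Set.range (γ g)) := by
    intro g g' hgg'
    refine Set.disjoint_left.2 fun z hz hz' => hgg' ?_
    let s : Spec (.of ((pullback f f).residueField z)) ⟶ pullback f f :=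
      (pullback f f).fromSpecResidueField z
    have hs : Set.range s = {z} := Scheme.range_fromSpecResidueField z
    -- The point `z`, as a morphism from the spectrum of its residue field, factors through both
    -- graphs because they are open immersions.
    have hl := IsOpenImmersion.lift_fac (γ g) s (by simpa [hs] using hz)
    have hl' := IsOpenImmersion.lift_fac (γ g') s (by simpa [hs] using hz')
    set l := IsOpenImmersion.lift (γ g) s (by simpa [hs] using hz)
    set l' := IsOpenImmersion.lift (γ g') s (by simpa [hs] using hz')
    have hll' : l = l' := by
      simpa [hγ₁] using congr($(hl.trans hl'.symm) ≫ pullback.fst f f)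
    refine (h _ l (s ≫ pullback.snd f f) ?_).unique ?_ ?_
    · rw [Category.assoc, ← pullback.condition, ← hl]
      simp [reassoc_of% hγ₁]
    · rw [← hl, Category.assoc, hγ₂]
    · rw [hll', ← hl', Category.assoc, hγ₂]
  have hopen : IsOpenImmersion (Sigma.desc γ) := isOpenImmersion_sigmaDesc _ γ hdisj
  have hsurj : Surjective (Sigma.desc γ) := by
    refine Surjective.sigmaDesc_of_union_range_eq_univ (Set.eq_univ_of_forall fun z => ?_)
    let s : Spec (.of ((pullback f f).residueField z)) ⟶ pullback f f :=
      (pullback f f).fromSpecResidueField z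
    obtain ⟨g, hg, -⟩ := h _ (s ≫ pullback.fst f f) (s ≫ pullback.snd f f)
      (by simp [pullback.condition])
    have hs : s = (s ≫ pullback.fst f f) ≫ γ g := by
      ext1
      · simp [hγ₁]
      · rw [Category.assoc, hγ₂, hg]
    obtain ⟨t, ht⟩ : z ∈ Set.range s := by
      rw [show Set.range s = {z} from Scheme.range_fromSpecResidueField z]; rfl
    refine Set.mem_iUnion.2 ⟨g, (s ≫ pullback.fst f f) t, ?_⟩
    rw [← Scheme.Hom.comp_apply, ← hs, ht]
  exact (isIso_iff_isOpenImmersion_and_surjective _).2 ⟨hopen, hsurj⟩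

namespace Veronese

variable {K : Type u} [Field K]

/-! ### Vectors with the same monomials of degree `q` -/

section points

/-- The exponent vector of the monomial `x_i ^ q`. -/
def powCoord {n : ℕ} (q : ℕ) (i : Fin n) : Exponent n q := ⟨Pi.single i q, by simp⟩

/-- The exponent vector of the monomial `x_i ^ (q - 1) * x_j`. -/
def mixedCoord {n q : ℕ} (hq : q ≠ 0) (i j : Fin n) : Exponent n q :=
  ⟨Pi.single i (q - 1) + Pi.single j 1, by simp [Finset.sum_add_distrib]; lia⟩

theorem prod_pow_powCoord {R : Type*} [CommMonoid R] {n : ℕ} (q : ℕ) (i : Fin n) (x : Fin n → R) :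
    ∏ k, x k ^ (powCoord q i).1 k = x i ^ q := by
  rw [Finset.prod_eq_single i (fun j _ hj => by simp [powCoord, hj]) (by simp)]
  simp [powCoord]

theorem prod_pow_mixedCoord {R : Type*} [CommMonoid R] {n q : ℕ} (hq : q ≠ 0) (i j : Fin n)
    (x : Fin n → R) : ∏ k, x k ^ (mixedCoord hq i j).1 k = x i ^ (q - 1) * x j := by
  simp_rw [mixedCoord, Pi.add_apply, pow_add, Finset.prod_mul_distrib]
  congr 1
  · rw [Finset.prod_eq_single i (fun j _ hj => by simp [hj]) (by simp)]
    simp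
  · rw [Finset.prod_eq_single j (fun k _ hj => by simp [hj]) (by simp)]
    simp

variable {L : Type*} [Field L] {n q : ℕ}

/-- Two nonzero vectors over a field at which all monomials of degree `q` agree differ by a `q`-th
root of unity. The monomials `x_i ^ q` and `x_i ^ (q - 1) * x_j`, for one `i` with `x_i ≠ 0`, are
enough. -/
theorem exists_smul_of_monomials_eq (hq : q ≠ 0) {x y : Fin n → L} (hx : x ≠ 0)
    (hxy : ∀ a : Exponent n q, ∏ i, x i ^ a.1 i = ∏ i, y i ^ a.1 i) :
    ∃ ζ : L, ζ ^ q = 1 ∧ ζ • x = y := by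
  obtain ⟨i, hi⟩ := Function.ne_iff.1 hx
  replace hi : x i ≠ 0 := hi
  have h1 : x i ^ q = y i ^ q := by simpa only [prod_pow_powCoord] using hxy (powCoord q i)
  have h2 (j : Fin n) : x i ^ (q - 1) * x j = y i ^ (q - 1) * y j := by
    simpa only [prod_pow_mixedCoord] using hxy (mixedCoord hq i j)
  have hq' : q = (q - 1) + 1 := by lia
  have hyi : y i ≠ 0 := fun h => hi <| by simpa [h, hq] using h1
  refine ⟨y i / x i, by rw [div_pow, ← h1, div_self (pow_ne_zero _ hi)], funext fun j => ?_⟩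
  have h3 : x i ^ (q - 1) * (y i * x j) = x i ^ (q - 1) * (x i * y j) := by
    have e : y i ^ (q - 1) * (y i * y j) = x i ^ (q - 1) * (x i * y j) := by
      rw [← mul_assoc, ← mul_assoc, ← pow_succ, ← pow_succ, ← hq', h1]
    rw [← e]
    linear_combination y i * h2 j
  have h4 := mul_left_cancel₀ (pow_ne_zero _ hi) h3
  rw [Pi.smul_apply, smul_eq_mul, div_mul_eq_mul_div, h4, mul_div_cancel_left₀ _ hi]

theorem prod_smul_pow (c : L) (x : Fin n → L) (a : Exponent n q) :
    ∏ i, (c • x) i ^ a.1 i = c ^ q * ∏ i, x i ^ a.1 i := by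
  simp_rw [Pi.smul_apply, smul_eq_mul, mul_pow, Finset.prod_mul_distrib,
    Finset.prod_pow_eq_pow_sum, a.2]

end points

/-- The group `μ_q` acts simply transitively on the set of `K`-points of each fibre of the
parametrization outside the origin. -/
theorem fibre_isTorsor (n : ℕ) {q : ℕ} (hq : q ≠ 0) {w : Exponent n q → K} (hw : w ∈ variety K n q)
    (hw0 : w ≠ 0) :
    (fibre K n q w).Nonempty ∧ ∀ x ∈ fibre K n q w,
      (∀ ζ : rootsOfUnity q K, ((ζ : Kˣ) : K) • x ∈ fibre K n q w) ∧
      ∀ y ∈ fibre K n q w, ∃! ζ : rootsOfUnity q K, ((ζ : Kˣ) : K) • x = y := by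
  refine ⟨?_, fun x hx => ⟨fun ζ => ⟨?_, ?_⟩, fun y hy => ?_⟩⟩
  · obtain ⟨x, rfl⟩ := hw
    refine ⟨x, fun hx => hw0 <| funext fun a => ?_, rfl⟩
    obtain ⟨i, hi⟩ : ∃ i, a.1 i ≠ 0 := by
      by_contra! h
      exact hq (by simp [← a.2, h])
    exact Finset.prod_eq_zero (Finset.mem_univ i) (by simp [hx, hi])
  · exact smul_ne_zero (Units.ne_zero _) hx.1
  · rw [← hx.2]
    ext a
    have hζ : ((ζ : Kˣ) : K) ^ q = 1 := (mem_rootsOfUnity' q _).1 ζ.2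
    simp only [param]
    rw [prod_smul_pow, hζ, one_mul]
  · obtain ⟨ζ, hζ, hζx⟩ := exists_smul_of_monomials_eq hq hx.1
      fun a => congrFun (hx.2.trans hy.2.symm) a
    have : NeZero q := ⟨hq⟩
    refine ⟨rootsOfUnity.mkOfPowEq ζ hζ, by simpa using hζx, fun ξ hξ => ?_⟩
    obtain ⟨i, hi⟩ := Function.ne_iff.1 hx.1
    ext
    have := congrFun (hξ.trans hζx.symm) i
    simpa using mul_right_cancel₀ hi this

/-- A field with a primitive `q`-th root of unity contains the `q`-th roots of unity of all its
extension fields. -/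
theorem exists_rootsOfUnity_algebraMap_eq {q : ℕ} [NeZero q] [HasEnoughRootsOfUnity K q]
    {L : Type*} [Field L] (α : K →+* L) {ξ : L} (hξ : ξ ^ q = 1) :
    ∃ ζ : rootsOfUnity q K, α ((ζ : Kˣ) : K) = ξ := by
  obtain ⟨z, hz⟩ := HasEnoughRootsOfUnity.exists_primitiveRoot K q
  obtain ⟨k, -, hk⟩ := (hz.map_of_injective α.injective).eq_pow_of_pow_eq_one hξ
  exact ⟨rootsOfUnity.mkOfPowEq (z ^ k) (by rw [← pow_mul, mul_comm, pow_mul, hz.pow_eq_one,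
    one_pow]), by simpa using hk⟩

/-! ### The comorphism -/

section algebra

variable [Infinite K] (n : ℕ) {q : ℕ}

theorem comorphism_mk (P : MvPolynomial (Exponent n q) K) :
    comorphism K n q (Ideal.Quotient.mk _ P) = monomialHom K n q P := rfl

theorem comorphism_coord (a : Exponent n q) :
    comorphism K n q (coord K n q a) = ∏ i, X i ^ a.1 i := by
  rw [coord, comorphism_mk, monomialHom, aeval_X]

theorem comorphism_injective (q : ℕ) : Function.Injective (comorphism K n q) := by
  refine (injective_iff_map_eq_zero _).2 fun P hP => ?_
  obtain ⟨P, rfl⟩ := Ideal.Quotient.mk_surjective P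
  rw [comorphism_mk] at hP
  rw [Ideal.Quotient.eq_zero_iff_mem]
  rintro _ ⟨x, rfl⟩
  rw [← aeval_monomialHom, hP, map_zero]

theorem scaleHom_comorphism {c : K} (hc : c ^ q = 1) (P : CoordRing K n q) :
    scaleHom K n c (comorphism K n q P) = comorphism K n q P := by
  have : (scaleHom K n c).comp (comorphism K n q) = comorphism K n q := by
    refine Ideal.Quotient.algHom_ext _ (MvPolynomial.algHom_ext fun a => ?_)
    change scaleHom K n c (comorphism K n q (coord K n q a)) = comorphism K n q (coord K n q a)
    simp only [comorphism_coord, map_prod, map_pow, scaleHom, aeval_X, mul_pow,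
      Finset.prod_mul_distrib, Finset.prod_pow_eq_pow_sum, a.2]
    rw [← C_pow, hc, C_1, one_mul]
  exact DFunLike.congr_fun this P

theorem comorphism_powCoord (i : Fin n) :
    comorphism K n q (coord K n q (powCoord q i)) = X i ^ q := by
  rw [comorphism_coord, prod_pow_powCoord]

theorem comorphism_finite (hq : q ≠ 0) : (comorphism K n q).toRingHom.Finite := by
  refine RingHom.IsIntegral.to_finite (fun P => ?_) ?_
  · induction P using MvPolynomial.induction_on with
    | C c =>
      have := (comorphism K n q).toRingHom.isIntegralElem_map (x := algebraMap K _ c)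
      rwa [AlgHom.toRingHom_eq_coe, RingHom.coe_coe, AlgHom.commutes] at this
    | add P Q hP hQ => exact hP.add _ hQ
    | mul_X P i hP =>
      refine hP.mul _ ⟨Polynomial.X ^ q - Polynomial.C (coord K n q (powCoord q i)),
        Polynomial.monic_X_pow_sub_C _ hq, ?_⟩
      simp [comorphism_powCoord]
  · refine RingHom.FiniteType.of_comp_finiteType (f := algebraMap K (CoordRing K n q)) ?_
    have : (comorphism K n q).toRingHom.comp (algebraMap K (CoordRing K n q)) =
        algebraMap K (MvPolynomial (Fin n) K) := (comorphism K n q).comp_algebraMap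
    rw [this, RingHom.finiteType_algebraMap]
    infer_instance

/-- The elements `1, u_i, …, u_i ^ (q - 1)` are linearly independent over `K[V]`. -/
theorem eq_zero_of_eval₂_comorphism [NeZero q] [HasEnoughRootsOfUnity K q]
    (i : Fin n) {P : Polynomial (CoordRing K n q)} (hdeg : P.natDegree < q)
    (hP : P.eval₂ (comorphism K n q).toRingHom (X i) = 0) : P = 0 := by
  rw [← Polynomial.map_eq_zero_iff (f := (comorphism K n q).toRingHom) (comorphism_injective n q)]
  have := Fintype.ofFinite (rootsOfUnity q K)
  -- In the domain `K[u_1, …, u_n]`, the `q` elements `ζ u_i` are distinct roots of `P`.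
  refine Polynomial.eq_zero_of_natDegree_lt_card_of_eval_eq_zero _
    (f := fun ζ : rootsOfUnity q K => C ((ζ : Kˣ) : K) * X i) (fun ζ ξ h => ?_) (fun ζ => ?_) ?_
  · ext
    exact C_injective _ _ (mul_right_cancel₀ (X_ne_zero i) h)
  · have := congr(scaleHom K n ((ζ : Kˣ) : K) $hP)
    rw [map_zero, ← AlgHom.coe_toRingHom, Polynomial.hom_eval₂] at this
    rw [Polynomial.eval_map, ← this]
    congr 1
    · refine RingHom.ext fun R => ?_
      exact (scaleHom_comorphism n ((mem_rootsOfUnity' q _).1 ζ.2) R).symm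
    · simp [scaleHom]
  · rw [← Nat.card_eq_fintype_card, HasEnoughRootsOfUnity.natCard_rootsOfUnity]
    exact Polynomial.natDegree_map_le.trans_lt hdeg

/-- The morphism `K ^ n → V` is étale on the locus where the `i`-th coordinate does not vanish. -/
theorem etale_comorphism_away [NeZero q] [HasEnoughRootsOfUnity K q] (hqK : (q : K) ≠ 0)
    (i : Fin n) :
    ((algebraMap (MvPolynomial (Fin n) K) (Localization.Away (X i : MvPolynomial (Fin n) K))).comp
      (comorphism K n q).toRingHom).Etale := by
  set B := MvPolynomial (Fin n) K
  set S := Localization.Away (X i : B)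
  set ψ : CoordRing K n q →+* S := (algebraMap B S).comp (comorphism K n q).toRingHom
  let : Algebra (CoordRing K n q) S := ψ.toAlgebra
  have halg (R) : algebraMap (CoordRing K n q) S R = algebraMap B S (comorphism K n q R) := rfl
  have : Nontrivial (CoordRing K n q) := (comorphism K n q).toRingHom.domain_nontrivial
  have hq : q ≠ 0 := NeZero.ne q
  have hqA : IsUnit (q : CoordRing K n q) := by
    simpa using (IsUnit.mk0 _ hqK).map (algebraMap K (CoordRing K n q))
  have hinjBS : Function.Injective (algebraMap B S) :=
    IsLocalization.injective S (powers_le_nonZeroDivisors_of_noZeroDivisors (X_ne_zero i))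
  obtain ⟨u, hu⟩ : IsUnit (algebraMap B S (X i)) := IsLocalization.Away.algebraMap_isUnit _
  change Algebra.Etale (CoordRing K n q) S
  refine Algebra.Etale.of_adjoin_root_of_isUnit hq hqA (coord K n q (powCoord q i)) u ?_ ?_ ?_
  · rw [halg, comorphism_powCoord, map_pow, hu]
  · set T := Algebra.adjoin (CoordRing K n q) {(u : S), ((u⁻¹ : Sˣ) : S)}
    have huT : ((u⁻¹ : Sˣ) : S) ∈ T := Algebra.subset_adjoin (by simp)
    have hB (P : B) : algebraMap B S P ∈ T := by
      induction P using MvPolynomial.induction_on with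
      | C c =>
        have := T.algebraMap_mem (algebraMap K _ c)
        rwa [halg, AlgHom.commutes] at this
      | add P Q hP hQ => rw [map_add]; exact T.add_mem hP hQ
      | mul_X P j hP =>
        rw [map_mul]
        refine T.mul_mem hP ?_
        set a := mixedCoord hq i j
        have ha : algebraMap _ S (coord K n q a) = (u : S) ^ (q - 1) * algebraMap B S (X j) := by
          rw [halg, comorphism_coord, hu, ← map_pow, ← map_mul, prod_pow_mixedCoord]
        have : algebraMap B S (X j) =
            ((u⁻¹ : Sˣ) : S) ^ (q - 1) * algebraMap _ S (coord K n q a) := by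
          rw [ha, ← mul_assoc, ← mul_pow, Units.inv_mul, one_pow, one_mul]
        rw [this]
        exact T.mul_mem (T.pow_mem huT _) (T.algebraMap_mem _)
    refine top_le_iff.1 fun s _ => ?_
    obtain ⟨k, b, hs⟩ := IsLocalization.Away.surj (X i : B) s
    have : s = algebraMap B S b * ((u⁻¹ : Sˣ) : S) ^ k := by
      rw [← hs, ← hu, mul_assoc, ← mul_pow, Units.mul_inv, one_pow, mul_one]
    rw [this]
    exact T.mul_mem (hB b) (T.pow_mem huT _)
  · intro P hdeg hP
    refine eq_zero_of_eval₂_comorphism n i hdeg (hinjBS ?_)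
    rw [map_zero, Polynomial.hom_eval₂, ← hu]
    exact hP

end algebra

/-! ### The morphism of punctured schemes -/

section morphism

variable (n : ℕ) {q : ℕ}

/-- A point of `K ^ n ∖ {0}` with values in a field `L` is given by a homomorphism
`K[u_1, …, u_n] → L` that does not send all variables to zero. -/
theorem exists_coordinates {L : Type u} [Field L]
    (y : Spec (.of L) ⟶ (affinePunctured K n).toScheme) :
    ∃ α : MvPolynomial (Fin n) K →+* L, y ≫ (affinePunctured K n).ι =
      Spec.map (CommRingCat.ofHom α) ∧ (fun i => α (X i)) ≠ 0 := by
  obtain ⟨α, hα⟩ := Spec.map_surjective (y ≫ (affinePunctured K n).ι)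
  refine ⟨α.hom, hα.symm, fun h0 => ?_⟩
  let t : Spec (.of L) := IsLocalRing.closedPoint L
  obtain ⟨i, hi⟩ := (mem_puncture _ _).1 (y t).2
  refine hi ?_
  have : (y t).1 = Spec.map α t := by rw [hα]; rfl
  rw [this]
  change α.hom (X i) ∈ t.asIdeal
  rw [show α.hom (X i) = 0 from congrFun h0 i]
  exact zero_mem _

variable [Infinite K]

/-- The origin is the only point of `K ^ n` over the origin of `V`. -/
theorem preimage_varietyPunctured (hq : q ≠ 0) :
    Spec.map (CommRingCat.ofHom (comorphism K n q).toRingHom) ⁻¹ᵁ varietyPunctured K n q =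
      affinePunctured K n := by
  refine le_antisymm (fun x hx => ?_) (affinePunctured_le K n q)
  obtain ⟨a, ha⟩ := (mem_puncture _ _).1 hx
  obtain ⟨i, hi⟩ : ∃ i, a.1 i ≠ 0 := by
    by_contra! h
    exact hq (by simp [← a.2, h])
  refine (mem_puncture _ x).2 ⟨i, fun h => ha ?_⟩
  change comorphism K n q (coord K n q a) ∈ x.asIdeal
  rw [comorphism_coord]
  exact x.asIdeal.mem_of_dvd (Finset.dvd_prod_of_mem
    (fun i => (X i ^ a.1 i : MvPolynomial (Fin n) K)) (Finset.mem_univ i))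
    (Ideal.pow_mem_of_mem _ h _ (Nat.pos_of_ne_zero hi))

theorem isFinite_phi (hq : q ≠ 0) : IsFinite (phi K n q) := by
  refine (Scheme.Hom.resLE_congr _ _ rfl (preimage_varietyPunctured n hq).symm @IsFinite).2 ?_
  rw [Scheme.Hom.resLE_eq_morphismRestrict]
  have := (IsFinite.SpecMap_iff (CommRingCat.ofHom (comorphism K n q).toRingHom)).2
    (comorphism_finite n hq)
  infer_instance

theorem surjective_phi (hq : q ≠ 0) : Surjective (phi K n q) := by
  refine (Scheme.Hom.resLE_congr _ _ rfl (preimage_varietyPunctured n hq).symm @Surjective).2 ?_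
  rw [Scheme.Hom.resLE_eq_morphismRestrict]
  have : Surjective (Spec.map (CommRingCat.ofHom (comorphism K n q).toRingHom)) :=
    ⟨(comorphism_finite n hq).to_isIntegral.comap_surjective (comorphism_injective n q)⟩
  exact IsZariskiLocalAtTarget.restrict this _

theorem etale_phi [NeZero q] [HasEnoughRootsOfUnity K q] (hqK : (q : K) ≠ 0) :
    Etale (phi K n q) := by
  set Φ := Spec.map (CommRingCat.ofHom (comorphism K n q).toRingHom)
  set Y := affinePunctured K n
  -- Étaleness is cancelled along the open immersion `V ∖ {0} ⟶ V`.
  suffices Etale (Y.ι ≫ Φ) by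
    have : Etale (phi K n q ≫ (varietyPunctured K n q).ι) := by
      rwa [phi, Scheme.Hom.resLE_comp_ι]
    exact Etale.of_comp _ (varietyPunctured K n q).ι
  let j (i : Fin n) := Spec.map (CommRingCat.ofHom (algebraMap (MvPolynomial (Fin n) K)
    (Localization.Away (X i : MvPolynomial (Fin n) K))))
  have hj (i : Fin n) : IsOpenImmersion (j i) := inferInstance
  have : IsZariskiLocalAtSource @Etale.{u} :=
    HasRingHomProperty.instIsZariskiLocalAtSource (Q := RingHom.Etale)
  refine IsZariskiLocalAtSource.of_iSup_eq_top (P := @Etale)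
    (fun i => Y.ι ⁻¹ᵁ (j i).opensRange) (top_le_iff.1 fun x _ => ?_) fun i => ?_
  · obtain ⟨i, hi⟩ := (mem_puncture _ _).1 x.2
    refine TopologicalSpace.Opens.mem_iSup.2 ⟨i, ?_⟩
    have : x.1 ∈ Set.range (j i) := by
      have := PrimeSpectrum.localization_away_comap_range
        (Localization.Away (X i : MvPolynomial (Fin n) K))
        (X i : MvPolynomial (Fin n) K)
      exact this.symm ▸ hi
    exact this
  · set k := (Y.ι ⁻¹ᵁ (j i).opensRange).ι ≫ Y.ι
    have hk : Set.range k ⊆ Set.range (j i) := by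
      rintro _ ⟨x, rfl⟩
      exact x.2
    have hjΦ : Etale (j i ≫ Φ) := by
      rw [← Spec.map_comp, ← CommRingCat.ofHom_comp, HasRingHomProperty.Spec_iff (P := @Etale)]
      exact etale_comorphism_away n hqK i
    have : IsOpenImmersion (IsOpenImmersion.lift (j i) k hk) := by
      have : IsOpenImmersion (IsOpenImmersion.lift (j i) k hk ≫ j i) := by
        rw [IsOpenImmersion.lift_fac]; infer_instance
      exact IsOpenImmersion.of_comp _ (j i)
    have hfac : (Y.ι ⁻¹ᵁ (j i).opensRange).ι ≫ Y.ι ≫ Φ =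
        IsOpenImmersion.lift (j i) k hk ≫ j i ≫ Φ := by
      rw [← Category.assoc, ← Category.assoc, IsOpenImmersion.lift_fac]
    rw [hfac]
    infer_instance

theorem scale_comp_phi {c : Kˣ} (hc : (c : K) ^ q = 1) : scale K n c ≫ phi K n q = phi K n q := by
  have : CommRingCat.ofHom (comorphism K n q).toRingHom ≫
      CommRingCat.ofHom (scaleHom K n (c : K)).toRingHom =
      CommRingCat.ofHom (comorphism K n q).toRingHom :=
    CommRingCat.hom_ext (RingHom.ext (scaleHom_comorphism n hc))
  rw [← cancel_mono (varietyPunctured K n q).ι, Category.assoc, phi, Scheme.Hom.resLE_comp_ι,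
    scale, Scheme.Hom.resLE_comp_ι_assoc, ← Spec.map_comp, this]

/-- The group `μ_q(K)` acts simply transitively on the nonempty fibres of `phi` on points with values
in any field `L`. No `K`-algebra structure on `L` is fixed: the two points induce the same one
because `K → K[u_1, …, u_n]` factors through `K[V]`. -/
theorem existsUnique_rootsOfUnity_of_comp_phi_eq [NeZero q] [HasEnoughRootsOfUnity K q]
    {L : Type u} [Field L]
    (y y' : Spec (.of L) ⟶ (affinePunctured K n).toScheme) (h : y ≫ phi K n q = y' ≫ phi K n q) :
    ∃! ζ : rootsOfUnity q K, y ≫ (rootsAction K n q ζ).hom = y' := by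
  obtain ⟨α, hα, hα0⟩ := exists_coordinates n y
  obtain ⟨β, hβ, -⟩ := exists_coordinates n y'
  have hcomp : α.comp (comorphism K n q).toRingHom = β.comp (comorphism K n q).toRingHom := by
    have h' := congr($h ≫ (varietyPunctured K n q).ι)
    simp only [Category.assoc, phi, Scheme.Hom.resLE_comp_ι] at h'
    rw [reassoc_of% hα, reassoc_of% hβ, ← Spec.map_comp, ← Spec.map_comp] at h'
    exact congr(CommRingCat.Hom.hom $(Spec.map_injective h'))
  have hC (c : K) : α (C c) = β (C c) := by
    have := DFunLike.congr_fun hcomp (algebraMap K _ c)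
    simpa [MvPolynomial.algebraMap_eq] using this
  have key (ζ : rootsOfUnity q K) : y ≫ (rootsAction K n q ζ).hom = y' ↔
      α (C ((ζ : Kˣ) : K)) • (fun i => α (X i)) = fun i => β (X i) := by
    rw [← cancel_mono (affinePunctured K n).ι, hβ, Category.assoc]
    change y ≫ scale K n ζ ≫ _ = _ ↔ _
    rw [scale, Scheme.Hom.resLE_comp_ι, reassoc_of% hα, ← Spec.map_comp, Spec.map_inj]
    constructor
    · intro e
      ext i
      have := congr(CommRingCat.Hom.hom $e (X i))
      simpa [scaleHom] using this
    · intro e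
      refine CommRingCat.hom_ext (MvPolynomial.ringHom_ext (fun c => ?_) fun i => ?_)
      · simpa [scaleHom, MvPolynomial.algebraMap_eq] using hC c
      · simpa [scaleHom] using congrFun e i
  obtain ⟨ξ, hξ, hξe⟩ := exists_smul_of_monomials_eq (NeZero.ne q) hα0 (y := fun i => β (X i))
    fun a => by
      have := DFunLike.congr_fun hcomp (coord K n q a)
      simpa [comorphism_coord] using this
  obtain ⟨ζ, rfl⟩ := exists_rootsOfUnity_algebraMap_eq (α.comp C) hξ
  refine ⟨ζ, (key ζ).2 hξe, fun ζ' hζ' => ?_⟩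
  obtain ⟨i, hi⟩ := Function.ne_iff.1 hα0
  ext
  exact (α.comp C).injective (mul_right_cancel₀ hi
    (congrFun (((key ζ').1 hζ').trans hξe.symm) i))

end morphism

end Veronese

/-! ### The Galois covering -/

theorem mainTheorem4 {K : Type u} [Field K] [IsAlgClosed K] (p h n : ℕ) (hp : p.Prime)
    (hh : 0 < h) (hn : 3 ≤ n) (hK : ringChar K ≠ p) :
    haveI : NeZero (p ^ h) := ⟨pow_ne_zero h hp.ne_zero⟩
    IsFinite (Veronese.phi K n (p ^ h)) ∧
    Etale (Veronese.phi K n (p ^ h)) ∧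
    Surjective (Veronese.phi K n (p ^ h)) ∧
    IsGaloisCovering (Veronese.phi K n (p ^ h)) (rootsOfUnity (p ^ h) K)
      (Veronese.rootsAction K n (p ^ h)) ∧
    IsCyclic (rootsOfUnity (p ^ h) K) ∧
    Nat.card (rootsOfUnity (p ^ h) K) = p ^ h ∧
    ∀ w ∈ Veronese.variety K n (p ^ h), w ≠ 0 →
      (Veronese.fibre K n (p ^ h) w).Nonempty ∧
      ∀ x ∈ Veronese.fibre K n (p ^ h) w,
        (∀ ζ : rootsOfUnity (p ^ h) K, ((ζ : Kˣ) : K) • x ∈ Veronese.fibre K n (p ^ h) w) ∧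
        ∀ y ∈ Veronese.fibre K n (p ^ h) w,
          ∃! ζ : rootsOfUnity (p ^ h) K, ((ζ : Kˣ) : K) • x = y := by
  have hq : p ^ h ≠ 0 := pow_ne_zero h hp.ne_zero
  have : NeZero (p ^ h) := ⟨hq⟩
  have hqK : ((p ^ h : ℕ) : K) ≠ 0 := by
    rw [Nat.cast_pow]
    refine pow_ne_zero _ fun h0 => ?_
    rcases hp.eq_one_or_self_of_dvd _ (ringChar.dvd h0) with h1 | h1
    · exact CharP.ringChar_ne_one h1
    · exact hK h1
  have : NeZero ((p ^ h : ℕ) : K) := ⟨hqK⟩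
  have hroots : HasEnoughRootsOfUnity K (p ^ h) := inferInstance
  have hetale := Veronese.etale_phi (K := K) n hqK
  have hsurj := Veronese.surjective_phi (K := K) n hq
  refine ⟨Veronese.isFinite_phi n hq, hetale, hsurj, ?_, inferInstance,
    HasEnoughRootsOfUnity.natCard_rootsOfUnity K (p ^ h),
    fun w hw hw0 => Veronese.fibre_isTorsor n hq hw hw0⟩
  exact IsGaloisCovering.of_etale _ _ _
    (fun ζ => Veronese.scale_comp_phi n ((mem_rootsOfUnity' _ _).1 ζ.2))
    fun L _ y y' hy => Veronese.existsUnique_rootsOfUnity_of_comp_phi_eq n y y' hy
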